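/- Let $q,h>0$, let $\theta_+=(1+q/h)^{1/4}-1$, and let $0<\theta_{ig}<\theta_{hl}<\theta_+$. Put $F(s)=q-h\big((1+s)^4-1\big)$ for $s\in[\theta_{hl},\theta_+]$; this is the value there of $q\,H(s-\theta_{ig})-h\big((1+s)^4-1\big)H(s-\theta_{hl})$, where $H$ is the Heaviside function with $H(0)=1$. For $a\in\mathbb{R}$ consider the free-interface problem of finding $R>0$, $c>0$ and $\theta\in C^1(\mathbb{R})$, twice differentiable off $\{a,a+R\}$, such that $$\theta_{xx}-c\theta_x=0\ \text{ on }(-\infty,a),\qquad \theta_{xx}-c\theta_x+q=0\ \text{ on }(a,a+R),\qquad \theta_{xx}-c\theta_x+F(\theta)=0\ \text{ on }(a+R,\infty),$$ $$\theta(x)\to 0\ \ (x\to-\infty),\qquad \theta(x)\to\theta_+\ \ (x\to+\infty),\qquad \theta(a)=\theta_{ig},\qquad \theta(a+R)=\theta_{hl},$$ and $\theta(x)\in[\theta_{hl},\theta_+]$ for $x>a+R$. (Since $\theta\in C^1(\mathbb{R})$, neither $\theta$ nor $\theta_x$ jumps at the interfaces.) Then the problem with $a=0$ has a solution $(R^*,c^*,\theta^*)$.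 The function $\theta^*$ is strictly increasing on $\mathbb{R}$, with $0<\theta^*<\theta_{ig}$ on $(-\infty,0)$, $\theta_{ig}<\theta^*<\theta_{hl}$ on $(0,R^*)$ and $\theta_{hl}<\theta^*<\theta_+$ on $(R^*,\infty)$. Moreover, the solution is unique up to translation: for every $a\in\mathbb{R}$, any solution $(R,c,\theta)$ of the problem satisfies $R=R^*$, $c=c^*$ and $\theta(x)=\theta^*(x-a)$ for all $x\in\mathbb{R}$. -/

import Mathlib

open Set Filter Topology

noncomputable section

/-- The burned temperature `θ₊ = (1 + q/h)^{1/4} - 1`, the positive zero of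
`q - h ((1 + s)⁴ - 1)`. -/
def thetaPlus (q h : ℝ) : ℝ := (1 + q / h) ^ (1 / 4 : ℝ) - 1

/-- The net heat production `F(s) = q - h ((1 + s)⁴ - 1)` on `[θhl, θ₊]`, where both the
reaction and the radiative heat loss are active. -/
def netHeat (q h s : ℝ) : ℝ := q - h * ((1 + s) ^ 4 - 1)

/-- `(R, c, θ)` solves the free interface problem whose ignition interface is located at `x = a`
and whose heat loss interface is located at `x = a + R`. The problem normalised by
`θ(0) = θig` is the case `a = 0`.

The second derivative is expressed by differentiability of `deriv θ`, so that `θ` is required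
to be twice differentiable off the interfaces. -/
structure IsFrontSolution (q h θig θhl a R c : ℝ) (θ : ℝ → ℝ) : Prop where
  R_pos : 0 < R
  c_pos : 0 < c
  /-- `θ ∈ C¹(ℝ)`; in particular `θ` and `θₓ` have no jump at the two interfaces. -/
  contDiff : ContDiff ℝ 1 θ
  /-- `θₓₓ - c θₓ = 0` ahead of the ignition interface. -/
  ode_cold : ∀ x ∈ Iio a, HasDerivAt (deriv θ) (c * deriv θ x) x
  tendsto_cold : Tendsto θ atBot (𝓝 0)
  /-- `θₓₓ - c θₓ + q = 0` between the interfaces. -/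
  ode_reaction : ∀ x ∈ Ioo a (a + R), HasDerivAt (deriv θ) (c * deriv θ x - q) x
  /-- `θₓₓ - c θₓ + F(θ) = 0` behind the heat loss interface. -/
  ode_loss : ∀ x ∈ Ioi (a + R),
    HasDerivAt (deriv θ) (c * deriv θ x - netHeat q h (θ x)) x
  /-- Behind the heat loss interface `θ` stays in the domain `[θhl, θ₊]` of `F`. -/
  range_loss : ∀ x ∈ Ioi (a + R), θ x ∈ Icc θhl (thetaPlus q h)
  tendsto_hot : Tendsto θ atTop (𝓝 (thetaPlus q h))
  ignition : θ a = θig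
  heat_loss : θ (a + R) = θhl

end

/-! In the variable y = c (x - a), with Y = c R, μ = q / c² and f = F / q, the unknown parameters
are Y and μ, and U'' - U' equals 0, -μ and -μ f(U) in the three zones. The first two zones are
explicit: U = θig e^y, then U' = (θig - μ) e^y + μ and U = U' + μ y. The condition U(Y) = θhl
determines μ from Y, and with it the slope θhl - μ Y at which the hot zone is entered. It remains to
choose Y so that the hot orbit tends to θ₊.

Existence is by shooting (`exists_trapped_trajectory`). In the hot zone a slope above μ stays above
μ and a negative slope stays negative. These are disjoint open conditions on Y, and each holds at
one endpoint of [log(θhl/θig), θhl/θig]. By connectedness some Y keeps the slope in [0, μ], and such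
an orbit increases to θ₊ (`trapped_trajectory`).

For uniqueness, take two fronts with Y₁ ≤ Y₂. The explicit formula gives μ₁ ≤ μ₂
(`IsScaledFront.μ_le_of_Y_le`). Since f is decreasing and nonnegative, a maximum principle
(`hot_profile_le`) orders the hot profiles, hence their entry slopes: θhl - μ₁ Y₁ ≤ θhl - μ₂ Y₂. So
μ₂ Y₂ ≤ μ₁ Y₁, which forces equality throughout. -/

/-! ### Global flows of bounded Lipschitz fields. -/

theorem exists_global_integralCurve {E : Type*} [NormedAddCommGroup E] [NormedSpace ℝ E]
    [CompleteSpace E] {v : E → E} {K L : NNReal} (hv : LipschitzWith K v)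
    (hL : ∀ x, ‖v x‖ ≤ L) (x₀ : E) :
    ∃ X : ℝ → E, X 0 = x₀ ∧ ∀ t, HasDerivAt X (v (X t)) t := by
  have loc : ∀ n : ℕ, ∃ X : ℝ → E, X 0 = x₀ ∧
      ∀ t ∈ Ioo (-(n + 1 : ℝ)) (n + 1), HasDerivAt X (v (X t)) t := by
    intro n
    have hn : (0 : ℝ) < n + 1 := by positivity
    -- A field bounded by L moves a point by at most L (n + 1) in time n + 1, so a ball of that
    -- radius removes any smallness condition on the time.
    have hpl : IsPicardLindelof (fun _ => v)
        (⟨0, by constructor <;> linarith⟩ : Icc (-(n + 1 : ℝ)) (n + 1)) x₀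
        (L * (n + 1)) 0 L K := by
      refine ⟨fun _ _ => hv.lipschitzOnWith, fun _ _ => continuousOn_const,
        fun _ _ x _ => hL x, ?_⟩
      simp
    obtain ⟨X, hX0, hX⟩ := hpl.exists_eq_forall_mem_Icc_hasDerivWithinAt₀
    exact ⟨X, hX0, fun t ht =>
      (hX t (Ioo_subset_Icc_self ht)).hasDerivAt (Icc_mem_nhds ht.1 ht.2)⟩
  choose X hX0 hX using loc
  have agree : ∀ m n : ℕ, m ≤ n → EqOn (X m) (X n) (Ioo (-(m + 1 : ℝ)) (m + 1)) := by
    intro m n hmn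
    have hmn' : (m : ℝ) ≤ n := by exact_mod_cast hmn
    have hm : (0 : ℝ) < m + 1 := by positivity
    refine ODE_solution_unique_of_mem_Ioo (v := fun _ => v) (s := fun _ => univ) (K := K)
      (t₀ := 0) (fun _ _ => hv.lipschitzOnWith) ⟨by linarith, hm⟩
      (fun t ht => ⟨hX m t ht, mem_univ _⟩)
      (fun t ht => ⟨hX n t ⟨by linarith [ht.1], by linarith [ht.2]⟩, mem_univ _⟩) ?_
    rw [hX0, hX0]
  refine ⟨fun t => X ⌈|t|⌉₊ t, by simp [hX0], fun t => ?_⟩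
  have hlt : ∀ s : ℝ, s ∈ Ioo (-((⌈|s|⌉₊ : ℝ) + 1)) ((⌈|s|⌉₊ : ℝ) + 1) := fun s => by
    have := Nat.le_ceil |s|
    exact abs_lt.mp (by linarith)
  -- The extra 1 makes N bound ⌈|s|⌉₊ for all s near t, also when |t| is an integer.
  set N := ⌈|t|⌉₊ + 1 with hN
  have hNt : t ∈ Ioo (-((N : ℝ) + 1)) ((N : ℝ) + 1) := by
    have := hlt t
    rw [hN]; push_cast
    exact ⟨by linarith [this.1], by linarith [this.2]⟩
  have hev : (fun s => X ⌈|s|⌉₊ s) =ᶠ[𝓝 t] X N := by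
    filter_upwards [Ioo_mem_nhds (hlt t).1 (hlt t).2] with s hs
    refine agree _ _ ?_ (hlt s)
    have h1 : |s| < (N : ℝ) := by rw [hN]; push_cast; exact abs_lt.mpr hs
    exact Nat.ceil_le.mpr h1.le
  have := (hX N t hNt).congr_of_eventuallyEq hev
  rwa [← hev.eq_of_nhds] at this

theorem dist_integralCurve_le {E : Type*} [NormedAddCommGroup E] [NormedSpace ℝ E]
    {v : E → E} {K : NNReal} (hv : LipschitzWith K v) {X Z : ℝ → E}
    (hX : ∀ t, HasDerivAt X (v (X t)) t) (hZ : ∀ t, HasDerivAt Z (v (Z t)) t) {t : ℝ}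
    (ht : 0 ≤ t) : dist (X t) (Z t) ≤ dist (X 0) (Z 0) * Real.exp (K * t) := by
  have := dist_le_of_trajectories_ODE (v := fun _ => v) (K := K) (a := 0) (b := t) (f := X)
    (g := Z) (δ := dist (X 0) (Z 0)) (fun _ => hv)
    (fun s _ => (hX s).continuousAt.continuousWithinAt) (fun s _ => (hX s).hasDerivWithinAt)
    (fun s _ => (hZ s).continuousAt.continuousWithinAt) (fun s _ => (hZ s).hasDerivWithinAt)
    le_rfl t ⟨ht, le_rfl⟩
  simpa using this

/-! ### The truncated hot zone field. -/

/-- Truncation of a real number to `[-1, B]`. -/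
noncomputable def truncate (B x : ℝ) : ℝ := max (-1) (min x B)

theorem lipschitzWith_truncate (B : ℝ) : LipschitzWith 1 (truncate B) :=
  (LipschitzWith.id.min_const B).const_max (-1)

theorem truncate_eq_self {B x : ℝ} (h₁ : -1 ≤ x) (h₂ : x ≤ B) : truncate B x = x := by
  simp [truncate, h₁, h₂]

theorem abs_truncate_le {B : ℝ} (hB : 1 ≤ B) (x : ℝ) : |truncate B x| ≤ B := by
  unfold truncate
  rw [abs_le]
  constructor
  · exact (neg_le_neg hB).trans (le_max_left _ _)
  · exact max_le (by linarith) (min_le_right _ _)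

/-- The truncated hot zone vector field; the third component of the state is the parameter. -/
noncomputable def hotField (B : ℝ) (g : ℝ → ℝ) (z : ℝ × ℝ × ℝ) : ℝ × ℝ × ℝ :=
  (truncate B z.2.1, truncate B z.2.1 - truncate B z.2.2 * g z.1, 0)

theorem norm_hotField_le {B C : ℝ} (hB : 1 ≤ B) {g : ℝ → ℝ} (hC : ∀ x, |g x| ≤ C)
    (z : ℝ × ℝ × ℝ) : ‖hotField B g z‖ ≤ B + B * C := by
  have h1 := abs_truncate_le hB z.2.1
  have h2 := abs_truncate_le hB z.2.2
  have hC0 : 0 ≤ C := (abs_nonneg _).trans (hC 0)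
  have hBC : 0 ≤ B * C := by positivity
  have h3 : |truncate B z.2.2 * g z.1| ≤ B * C := by
    rw [abs_mul]; exact mul_le_mul h2 (hC _) (abs_nonneg _) (by linarith)
  refine norm_prod_le_iff.mpr ⟨?_, norm_prod_le_iff.mpr ⟨?_, ?_⟩⟩
  · simp only [hotField, Real.norm_eq_abs]; linarith
  · simp only [hotField, Real.norm_eq_abs]
    exact (abs_sub _ _).trans (by linarith)
  · simp only [hotField, norm_zero]; linarith

theorem exists_lipschitzWith_hotField {B C : ℝ} (hB : 1 ≤ B) {g : ℝ → ℝ} {k : NNReal}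
    (hg : LipschitzWith k g) (hC : ∀ x, |g x| ≤ C) :
    ∃ K, LipschitzWith K (hotField B g) := by
  have hC0 : 0 ≤ C := (abs_nonneg _).trans (hC 0)
  refine ⟨Real.toNNReal (1 + C + B * k), LipschitzWith.of_dist_le_mul fun z w => ?_⟩
  have hk : 0 ≤ B * (k : ℝ) := by positivity
  rw [Real.coe_toNNReal _ (by linarith)]
  have hT : ∀ x y, |truncate B x - truncate B y| ≤ |x - y| := fun x y => by
    simpa [Real.dist_eq] using (lipschitzWith_truncate B).dist_le_mul x y
  have hG : |g z.1 - g w.1| ≤ k * |z.1 - w.1| := by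
    simpa [Real.dist_eq] using hg.dist_le_mul z.1 w.1
  set D := dist z w
  have hD : 0 ≤ D := dist_nonneg
  have d1 : |z.1 - w.1| ≤ D := by rw [← Real.dist_eq]; exact le_max_left _ _
  have d2 : |z.2.1 - w.2.1| ≤ D := by
    rw [← Real.dist_eq]; exact (le_max_left _ _).trans (le_max_right _ _)
  have d3 : |z.2.2 - w.2.2| ≤ D := by
    rw [← Real.dist_eq]; exact (le_max_right _ _).trans (le_max_right _ _)
  have e1 : |truncate B z.2.1 - truncate B w.2.1| ≤ D := (hT _ _).trans d2
  have e2 : |truncate B z.2.2 * g z.1 - truncate B w.2.2 * g w.1| ≤ (C + B * k) * D := by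
    have : truncate B z.2.2 * g z.1 - truncate B w.2.2 * g w.1 =
      (truncate B z.2.2 - truncate B w.2.2) * g z.1 + truncate B w.2.2 * (g z.1 - g w.1) := by
      ring
    rw [this]
    refine (abs_add_le _ _).trans ?_
    rw [abs_mul, abs_mul]
    have f1 : |truncate B z.2.2 - truncate B w.2.2| * |g z.1| ≤ D * C :=
      mul_le_mul ((hT _ _).trans d3) (hC _) (abs_nonneg _) hD
    have f2 : |truncate B w.2.2| * |g z.1 - g w.1| ≤ B * (k * D) :=
      mul_le_mul (abs_truncate_le hB _) (hG.trans (by gcongr)) (abs_nonneg _) (by linarith)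
    linarith
  have hCD : 0 ≤ C * D := by positivity
  have hkD : 0 ≤ B * k * D := by positivity
  refine max_le ?_ (max_le ?_ ?_)
  · simp only [hotField, Real.dist_eq]; linarith
  · simp only [hotField, Real.dist_eq]
    rw [show ∀ a b c d : ℝ, a - b - (c - d) = (a - c) - (b - d) by intros; ring]
    exact (abs_sub _ _).trans (by linarith)
  · simp only [hotField, dist_self]; nlinarith

/-! ### Barriers and forward invariance. -/

theorem le_of_hasDerivAt_pos_of_eq {f f' : ℝ → ℝ} {a l : ℝ}
    (hf : ∀ t, a ≤ t → HasDerivAt f (f' t) t) (ha : l ≤ f a)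
    (hpos : ∀ t, a ≤ t → f t = l → 0 < f' t) {t : ℝ} (ht : a ≤ t) : l ≤ f t := by
  refine image_le_of_deriv_right_lt_deriv_boundary' (f := fun _ => l) (f' := fun _ => 0)
    (a := a) (b := t) continuousOn_const (fun x _ => hasDerivWithinAt_const _ _ _) ha
    (fun x hx => (hf x hx.1).continuousAt.continuousWithinAt)
    (fun x hx => (hf x hx.1).hasDerivWithinAt) (fun x hx h => hpos x hx.1 h.symm) ⟨ht, le_rfl⟩

theorem add_mul_le_of_le_hasDerivAt {f f' : ℝ → ℝ} {a e : ℝ}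
    (hf : ∀ t, a ≤ t → HasDerivAt f (f' t) t) (he : ∀ t, a ≤ t → e ≤ f' t) {t : ℝ}
    (ht : a ≤ t) : f a + e * (t - a) ≤ f t := by
  have := (convex_Ici a).mul_sub_le_image_sub_of_le_deriv (f := f) (C := e)
    (fun x hx => (hf x hx).continuousAt.continuousWithinAt)
    (fun x hx => (hf x (interior_subset hx)).differentiableAt.differentiableWithinAt)
    (fun x hx => by rw [(hf x (interior_subset hx)).deriv]; exact he x (interior_subset hx))
    a self_mem_Ici t ht ht
  linarith

theorem exists_lt_of_le_hasDerivAt {f f' : ℝ → ℝ} {a e : ℝ} (he0 : 0 < e)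
    (hf : ∀ t, a ≤ t → HasDerivAt f (f' t) t) (he : ∀ t, a ≤ t → e ≤ f' t) (M : ℝ) :
    ∃ t, a ≤ t ∧ M < f t := by
  refine ⟨a + (|M - f a| + 1) / e, by have : 0 ≤ (|M - f a| + 1) / e := by positivity
                                      linarith, ?_⟩
  have h0 : 0 ≤ (|M - f a| + 1) / e := by positivity
  have := add_mul_le_of_le_hasDerivAt hf he (t := a + (|M - f a| + 1) / e) (by linarith)
  have h2 : e * (a + (|M - f a| + 1) / e - a) = |M - f a| + 1 := by field_simp; ring
  rw [h2] at this
  linarith [le_abs_self (M - f a)]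

section Trapping

variable {B μ : ℝ} {g u p : ℝ → ℝ}

/-- The barrier is a level l strictly between μ and min(p t₀, B): there p' = l - μ g(u) > 0, whereas
at the level μ itself the derivative may vanish. -/
theorem lt_of_lt_truncated (hμB : μ + 1 ≤ B) (hμ : 0 ≤ μ) (hg1 : ∀ x, g x ≤ 1)
    (hp : ∀ t, HasDerivAt p (truncate B (p t) - μ * g (u t)) t) {t₀ t : ℝ} (h : μ < p t₀)
    (ht : t₀ ≤ t) : μ < p t := by
  obtain ⟨l, hl, hl'⟩ := exists_between (lt_min h (show μ < B by linarith))
  refine hl.trans_le (le_of_hasDerivAt_pos_of_eq (fun s _ => hp s)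
    (hl'.le.trans (min_le_left _ _)) (fun s _ hs => ?_) ht)
  rw [hs, truncate_eq_self (by linarith) (hl'.le.trans (min_le_right _ _))]
  nlinarith [hg1 (u s)]

theorem neg_of_neg_truncated (hB : 0 ≤ B) (hμ : 0 ≤ μ) (hg0 : ∀ x, 0 ≤ g x)
    (hp : ∀ t, HasDerivAt p (truncate B (p t) - μ * g (u t)) t) {t₀ t : ℝ} (h : p t₀ < 0)
    (ht : t₀ ≤ t) : p t < 0 := by
  obtain ⟨l, hl, hl'⟩ := exists_between (max_lt h (show (-1 : ℝ) < 0 by norm_num))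
  have : -l ≤ -p t := by
    refine le_of_hasDerivAt_pos_of_eq (f := fun s => -p s) (a := t₀) (fun s _ => (hp s).neg)
      ?_ (fun s _ hs => ?_) ht
    · exact neg_le_neg ((le_max_left _ _).trans hl.le)
    · rw [neg_inj.mp hs, truncate_eq_self ((le_max_right _ _).trans hl.le) (by linarith)]
      nlinarith [mul_nonneg hμ (hg0 (u s))]
  linarith

end Trapping

/-! ### Shooting and trapped orbits. -/

/-- Shooting: if a connected family of initial slopes contains one that overshoots and one that
is negative, then some member has a slope trapped in `[0, m i]` for all positive times. -/
theorem exists_trapped_trajectory {T : Type*} [TopologicalSpace T] [PreconnectedSpace T]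
    {s m : T → ℝ} (hs : Continuous s) (hm : Continuous m) {B : ℝ} (hm0 : ∀ i, 0 ≤ m i)
    (hmB : ∀ i, m i + 1 ≤ B) {i₀ i₁ : T} (h₀ : m i₀ < s i₀) (h₁ : s i₁ < 0)
    {g : ℝ → ℝ} {k : NNReal} (hg : LipschitzWith k g) (hg0 : ∀ x, 0 ≤ g x)
    (hg1 : ∀ x, g x ≤ 1) (u₀ : ℝ) :
    ∃ (i : T) (u p : ℝ → ℝ), u 0 = u₀ ∧ p 0 = s i ∧ (∀ t, 0 ≤ t → 0 ≤ p t ∧ p t ≤ m i) ∧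
      (∀ t, 0 ≤ t → HasDerivAt u (p t) t) ∧
      ∀ t, 0 ≤ t → HasDerivAt p (p t - m i * g (u t)) t := by
  have hB : 1 ≤ B := by linarith [hm0 i₀, hmB i₀]
  have hC : ∀ x, |g x| ≤ 1 := fun x => abs_le.mpr ⟨by linarith [hg0 x], hg1 x⟩
  obtain ⟨K, hK⟩ := exists_lipschitzWith_hotField hB hg hC
  have hbd : ∀ z, ‖hotField B g z‖ ≤ (Real.toNNReal (B + B * 1) : NNReal) := fun z => by
    rw [Real.coe_toNNReal _ (by linarith)]; exact norm_hotField_le hB hC z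
  choose X hX0 hX using exists_global_integralCurve hK hbd
  have hcont : ∀ t, 0 ≤ t → Continuous fun z => X z t := fun t ht => by
    refine (LipschitzWith.of_dist_le_mul (K := Real.toNNReal (Real.exp (K * t)))
      fun z w => ?_).continuous
    rw [Real.coe_toNNReal _ (Real.exp_pos _).le, mul_comm]
    simpa [hX0] using dist_integralCurve_le hK (hX z) (hX w) ht
  -- The parameter is part of the initial state, so continuous dependence on initial data covers it
  -- as well.
  set z : T → ℝ × ℝ × ℝ := fun i => (u₀, s i, m i) with hz
  have hzc : Continuous z := by fun_prop
  set U : T → ℝ → ℝ := fun i t => (X (z i) t).1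
  set P : T → ℝ → ℝ := fun i t => (X (z i) t).2.1
  have hQ : ∀ i t, (X (z i) t).2.2 = m i := fun i t => by
    have hd : ∀ t, HasDerivAt (fun t => (X (z i) t).2.2) 0 t := fun t => by
      exact (hX (z i) t).snd.snd
    have := is_const_of_deriv_eq_zero (fun t => (hd t).differentiableAt) (fun t => (hd t).deriv) t 0
    simpa [hX0, hz] using this
  have hU : ∀ i t, HasDerivAt (U i) (truncate B (P i t)) t := fun i t => (hX (z i) t).fst
  have hP : ∀ i t, HasDerivAt (P i) (truncate B (P i t) - m i * g (U i t)) t := fun i t => by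
    have := (hX (z i) t).snd.fst
    simp only [hotField, hQ] at this
    rwa [truncate_eq_self (x := m i) (by linarith [hm0 i]) (by linarith [hmB i])] at this
  have hPc : ∀ t, 0 ≤ t → Continuous fun i => P i t := fun t ht =>
    ((hcont t ht).comp hzc).snd.fst
  have hP0 : ∀ i, P i 0 = s i := fun i => by simp [P, hX0, hz]
  have hU0 : ∀ i, U i 0 = u₀ := fun i => by simp [U, hX0, hz]
  set Over : Set T := ⋃ t : Ici (0 : ℝ), {i | m i < P i t} with hOver
  set Under : Set T := ⋃ t : Ici (0 : ℝ), {i | P i t < 0} with hUnder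
  have hOo : IsOpen Over := isOpen_iUnion fun t => isOpen_lt hm (hPc t t.2)
  have hUo : IsOpen Under := isOpen_iUnion fun t => isOpen_lt (hPc t t.2) continuous_const
  -- Both conditions persist forward in time, so at the later of the two times the slope would be
  -- both above m i ≥ 0 and negative.
  have hdisj : ¬ (Over ∩ Under).Nonempty := by
    rintro ⟨i, hi, hi'⟩
    simp only [hOver, hUnder, mem_iUnion, mem_ofPred_eq] at hi hi'
    obtain ⟨⟨t, ht⟩, hi⟩ := hi
    obtain ⟨⟨t', ht'⟩, hi'⟩ := hi'
    have a1 := lt_of_lt_truncated (hmB i) (hm0 i) hg1 (hP i) hi (le_max_left t t')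
    have a2 := neg_of_neg_truncated (by linarith) (hm0 i) hg0 (hP i) hi' (le_max_right t t')
    linarith [hm0 i]
  have hnot : ∃ i, i ∉ Over ∪ Under := by
    by_contra! hcon
    have := isPreconnected_univ (α := T) Over Under hOo hUo (fun i _ => hcon i)
      ⟨i₀, mem_univ _, mem_iUnion.mpr ⟨⟨0, self_mem_Ici⟩, by simpa [hP0] using h₀⟩⟩
      ⟨i₁, mem_univ _, mem_iUnion.mpr ⟨⟨0, self_mem_Ici⟩, by simpa [hP0] using h₁⟩⟩
    rw [univ_inter] at this
    exact hdisj this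
  obtain ⟨i, hi⟩ := hnot
  have htrap : ∀ t, 0 ≤ t → 0 ≤ P i t ∧ P i t ≤ m i := fun t ht => by
    constructor
    · by_contra! h
      exact hi (Or.inr (mem_iUnion.mpr ⟨⟨t, ht⟩, h⟩))
    · by_contra! h
      exact hi (Or.inl (mem_iUnion.mpr ⟨⟨t, ht⟩, h⟩))
  have htr : ∀ t, 0 ≤ t → truncate B (P i t) = P i t := fun t ht =>
    truncate_eq_self (by linarith [(htrap t ht).1]) (by linarith [(htrap t ht).2, hmB i])
  refine ⟨i, U i, P i, hU0 i, hP0 i, htrap, fun t ht => ?_, fun t ht => ?_⟩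
  · simpa only [htr t ht] using hU i t
  · simpa only [htr t ht] using hP i t

/-- The behaviour of a trapped trajectory. -/
theorem trapped_trajectory {μ b : ℝ} (hμ : 0 < μ) {g u p : ℝ → ℝ} {k : NNReal}
    (hg : LipschitzWith k g) (hanti : Antitone g) (hgpos : ∀ x, x < b → 0 < g x)
    (hgb : ∀ x, b ≤ x → g x = 0) (hu0 : u 0 < b)
    (hp : ∀ t, 0 ≤ t → 0 ≤ p t ∧ p t ≤ μ) (hu : ∀ t, 0 ≤ t → HasDerivAt u (p t) t)
    (hdp : ∀ t, 0 ≤ t → HasDerivAt p (p t - μ * g (u t)) t) :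
    (∀ t, 0 ≤ t → 0 < p t) ∧ (∀ t, 0 ≤ t → u t < b) ∧ Tendsto u atTop (𝓝 b) := by
  have hg0 : ∀ x, 0 ≤ g x := fun x => by
    rcases lt_or_ge x b with h | h
    · exact (hgpos x h).le
    · exact (hgb x h).ge
  have mono : ∀ s t, 0 ≤ s → s ≤ t → u s ≤ u t := fun s t hs hst => by
    have := add_mul_le_of_le_hasDerivAt (f := u) (a := s) (e := 0)
      (fun r hr => hu r (hs.trans hr)) (fun r hr => (hp r (hs.trans hr)).1) hst
    linarith
  -- Beyond b the source vanishes and p' = p, so a positive slope would grow past μ.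
  have hzero : ∀ t, 0 ≤ t → b ≤ u t → p t = 0 := fun t ht hbt => by
    by_contra hne
    have hpos : 0 < p t := lt_of_le_of_ne (hp t ht).1 (Ne.symm hne)
    have hderiv : ∀ r, t ≤ r → HasDerivAt p (p r) r := fun r hr => by
      have := hdp r (ht.trans hr)
      rwa [hgb _ (hbt.trans (mono t r ht hr)), mul_zero, sub_zero] at this
    have hge : ∀ r, t ≤ r → p t ≤ p r := fun r hr => by
      have := add_mul_le_of_le_hasDerivAt (e := 0) hderiv
        (fun x hx => (hp x (ht.trans hx)).1) hr
      linarith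
    obtain ⟨r, hr, hr'⟩ := exists_lt_of_le_hasDerivAt hpos hderiv hge μ
    linarith [(hp r (ht.trans hr)).2]
  have hle : ∀ t, 0 ≤ t → u t ≤ b := fun t ht => by
    by_contra! hlt
    have hc : ContinuousOn u (Icc 0 t) := fun r hr => (hu r hr.1).continuousAt.continuousWithinAt
    obtain ⟨r, hr, hr'⟩ := intermediate_value_Icc ht hc
      (show (b + u t) / 2 ∈ Icc (u 0) (u t) from ⟨by linarith, by linarith⟩)
    have hz : ∀ x, r ≤ x → p x = 0 := fun x hx =>
      hzero x (hr.1.trans hx) (le_trans (by linarith) (mono r x hr.1 hx))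
    have := add_mul_le_of_le_hasDerivAt (f := fun x => -u x) (a := r) (e := 0)
      (fun x hx => (hu x (hr.1.trans hx)).neg) (fun x hx => by rw [hz x hx]; simp) hr.2
    linarith
  -- With E = (b - u) + p, one has E' = -μ g(u) ≥ -μ k E, so E cannot reach zero in finite time.
  -- Reaching u = b would force p = 0 and hence E = 0.
  have hEpos : ∀ t, 0 ≤ t → 0 < (b - u t) + p t := fun t ht => by
    have hE : ∀ r, 0 ≤ r → HasDerivAt (fun x => Real.exp (μ * k * x) * ((b - u x) + p x))
        (Real.exp (μ * k * r) * (μ * k) * ((b - u r) + p r) +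
          Real.exp (μ * k * r) * (-p r + (p r - μ * g (u r)))) r := fun r hr => by
      have e1 : HasDerivAt (fun x => Real.exp (μ * k * x)) (Real.exp (μ * k * r) * (μ * k)) r := by
        simpa using ((hasDerivAt_id r).const_mul (μ * k)).exp
      exact e1.mul (((hu r hr).const_sub b).add (hdp r hr))
    have := add_mul_le_of_le_hasDerivAt (e := 0) hE (fun r hr => ?_) ht
    · simp only [mul_zero, Real.exp_zero, one_mul, zero_mul, add_zero] at this
      have h0 : 0 < (b - u 0) + p 0 := by linarith [(hp 0 le_rfl).1]
      exact pos_of_mul_pos_right (h0.trans_le this) (Real.exp_pos _).le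
    · have h1 : g (u r) ≤ k * (b - u r) := by
        have := hg.dist_le_mul (u r) b
        rw [Real.dist_eq, Real.dist_eq, hgb b le_rfl, sub_zero, abs_of_nonneg (hg0 _),
          abs_of_nonpos (by linarith [hle r hr])] at this
        linarith
      have h2 : 0 ≤ μ * (k * (b - u r) - g (u r)) := mul_nonneg hμ.le (by linarith)
      have h3 : 0 ≤ μ * k * p r := mul_nonneg (by positivity) (hp r hr).1
      have h4 : 0 ≤ Real.exp (μ * k * r) * (μ * (k * (b - u r) - g (u r)) + μ * k * p r) :=
        mul_nonneg (Real.exp_pos _).le (by linarith)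
      linarith
  have hlt : ∀ t, 0 ≤ t → u t < b := fun t ht => by
    refine lt_of_le_of_ne (hle t ht) fun h => ?_
    have := hEpos t ht
    rw [h, hzero t ht h.ge] at this
    simp at this
  refine ⟨fun t ht => ?_, hlt, ?_⟩
  · refine lt_of_le_of_ne (hp t ht).1 fun h => ?_
    -- At a zero of p the derivative is -μ g(u) < 0, so p would be negative just afterwards.
    have hd := hdp t ht
    rw [← h, zero_sub] at hd
    have hneg : -(μ * g (u t)) < 0 := by have := hgpos _ (hlt t ht); nlinarith
    have hev : ∀ᶠ x in 𝓝[>] t, slope p t x < 0 :=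
      (hasDerivAt_iff_tendsto_slope.mp hd |>.mono_left
        (nhdsWithin_mono _ fun x hx => ne_of_gt hx)).eventually_lt_const hneg
    obtain ⟨x, hx, hxt⟩ := (hev.and self_mem_nhdsWithin).exists
    have hxt' : t < x := hxt
    rw [slope_def_field, ← h, sub_zero] at hx
    have := div_nonneg (hp x (ht.trans hxt'.le)).1 (sub_pos.mpr hxt').le
    linarith
  · refine tendsto_order.mpr ⟨fun a ha => ?_, fun a ha => ?_⟩
    · have : ∃ t, 0 ≤ t ∧ a < u t := by
        by_contra! hcon
        -- If u stayed below a < b, then u - p would grow at least linearly, yet it is less than b.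
        have hd : ∀ t, 0 ≤ t → HasDerivAt (fun x => u x - p x) (μ * g (u t)) t := fun t ht =>
          ((hu t ht).sub (hdp t ht)).congr_deriv (by ring)
        obtain ⟨t, ht, h⟩ := exists_lt_of_le_hasDerivAt (e := μ * g a)
          (mul_pos hμ (hgpos a ha)) hd
          (fun t ht => mul_le_mul_of_nonneg_left (hanti (hcon t ht)) hμ.le) b
        linarith [hlt t ht, (hp t ht).1]
      obtain ⟨t, ht, h⟩ := this
      filter_upwards [eventually_ge_atTop t] with x hx
      exact h.trans_le (mono t x ht hx)
    · filter_upwards [eventually_ge_atTop 0] with x hx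
      exact (hlt x hx).trans ha

/-! ### The rescaled problem and the maximum principle. -/

/-- The free interface problem in the variable `y = c (x - a)`, with `Y = c R`, `μ = q / c²` and
`f = F / q`. The derivative of the profile `U` is `P`. -/
structure IsScaledFront (f : ℝ → ℝ) (θig θhl b Y μ : ℝ) (U P : ℝ → ℝ) : Prop where
  Y_pos : 0 < Y
  μ_pos : 0 < μ
  hasDerivAt : ∀ y, HasDerivAt U (P y) y
  cont : Continuous P
  cold : ∀ y < 0, HasDerivAt P (P y) y
  tendsto_cold : Tendsto U atBot (𝓝 0)
  reaction : ∀ y ∈ Ioo 0 Y, HasDerivAt P (P y - μ) y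
  loss : ∀ y, Y < y → HasDerivAt P (P y - μ * f (U y)) y
  range_loss : ∀ y, Y < y → U y ∈ Icc θhl b
  tendsto_hot : Tendsto U atTop (𝓝 b)
  ignition : U 0 = θig
  heat_loss : U Y = θhl

theorem eq_of_hasDerivAt_zero {f : ℝ → ℝ} {a b : ℝ} (hab : a ≤ b) (hf : Continuous f)
    (hd : ∀ x ∈ Ioo a b, HasDerivAt f 0 x) : f a = f b := by
  rcases hab.eq_or_lt with rfl | hlt
  · rfl
  · obtain ⟨c, _, h⟩ := exists_hasDerivAt_eq_slope f (fun _ => 0) hlt hf.continuousOn hd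
    rw [eq_comm, div_eq_zero_iff] at h
    rcases h with h | h <;> linarith

theorem hasDerivAt_mul_exp_neg {f : ℝ → ℝ} {f' y : ℝ} (h : HasDerivAt f f' y) :
    HasDerivAt (fun x => f x * Real.exp (-x)) ((f' - f y) * Real.exp (-y)) y :=
  (h.mul (hasDerivAt_neg y).exp).congr_deriv (by ring)

/-- Comparison of hot zone profiles by the maximum principle. -/
theorem hot_profile_le {f : ℝ → ℝ} {α b μ₁ μ₂ : ℝ} (hf : StrictAntiOn f (Icc α b))
    (hfb : f b = 0) (hμ₁ : 0 < μ₁) (hμ : μ₁ ≤ μ₂) {u₁ p₁ u₂ p₂ : ℝ → ℝ}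
    (h₁ : ∀ t, HasDerivAt u₁ (p₁ t) t) (h₂ : ∀ t, HasDerivAt u₂ (p₂ t) t)
    (hp₁ : ∀ t, 0 < t → HasDerivAt p₁ (p₁ t - μ₁ * f (u₁ t)) t)
    (hp₂ : ∀ t, 0 < t → HasDerivAt p₂ (p₂ t - μ₂ * f (u₂ t)) t)
    (hr₁ : ∀ t, 0 < t → u₁ t ∈ Icc α b) (hr₂ : ∀ t, 0 < t → u₂ t ∈ Icc α b)
    (ht₁ : Tendsto u₁ atTop (𝓝 b)) (ht₂ : Tendsto u₂ atTop (𝓝 b))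
    (h0 : u₁ 0 = u₂ 0) {t : ℝ} (ht : 0 ≤ t) : u₁ t ≤ u₂ t := by
  by_contra! hlt
  set d : ℝ → ℝ := fun x => u₁ x - u₂ x with hd
  have hdd : ∀ x, HasDerivAt d (p₁ x - p₂ x) x := fun x => (h₁ x).sub (h₂ x)
  have hdc : Continuous d := continuous_iff_continuousAt.mpr fun x => (hdd x).continuousAt
  have hdt : 0 < d t := sub_pos.mpr hlt
  have hlim : Tendsto d atTop (𝓝 0) := by simpa using ht₁.sub ht₂
  obtain ⟨N, hN⟩ := eventually_atTop.mp (hlim.eventually_lt_const hdt)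
  have htN : t < N := by
    by_contra! h
    exact lt_irrefl _ (hN t h)
  obtain ⟨x, hx, hmax⟩ := isCompact_Icc.exists_isMaxOn (s := Icc 0 N) ⟨t, ht, htN.le⟩
    hdc.continuousOn
  have hxt : d t ≤ d x := hmax ⟨ht, htN.le⟩
  have hx0 : 0 < x := lt_of_le_of_ne hx.1 fun h => by
    rw [← h] at hxt
    simp only [hd, h0, sub_self] at hxt
    linarith
  have hxN : x < N := by
    by_contra! h
    linarith [hN x h]
  have hloc : IsLocalMax d x := hmax.isLocalMax (Icc_mem_nhds hx0 hxN)
  have hcrit : p₁ x - p₂ x = 0 := hloc.hasDerivAt_eq_zero (hdd x)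
  have hderiv : deriv d = fun y => p₁ y - p₂ y := funext fun y => (hdd y).deriv
  have hdd2 : deriv (deriv d) x = μ₂ * f (u₂ x) - μ₁ * f (u₁ x) := by
    have : HasDerivAt (fun y => p₁ y - p₂ y) _ x := (hp₁ x hx0).sub (hp₂ x hx0)
    rw [hderiv, this.deriv]
    linarith
  -- At a positive maximum of d, u₂ < u₁ gives f(u₁) < f(u₂), and f(u₂) ≥ 0 allows μ₁ to be replaced
  -- by the larger μ₂.
  have hpos : 0 < deriv (deriv d) x := by
    rw [hdd2]
    have hu : u₂ x < u₁ x := sub_pos.mp (hdt.trans_le hxt)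
    have h3 : f (u₁ x) < f (u₂ x) := hf (hr₂ x hx0) (hr₁ x hx0) hu
    have h4 : 0 ≤ f (u₂ x) := by
      rw [← hfb]
      exact hf.antitoneOn (hr₂ x hx0) ⟨(hr₂ x hx0).1.trans (hr₂ x hx0).2, le_rfl⟩ (hr₂ x hx0).2
    nlinarith [mul_le_mul_of_nonneg_right hμ h4, mul_lt_mul_of_pos_left h3 hμ₁]
  -- A maximum that is also a local minimum makes d locally constant, contradicting d'' > 0.
  have hmin : IsLocalMin d x :=
    isLocalMin_of_deriv_deriv_pos hpos (by rw [(hdd x).deriv, hcrit]) hdc.continuousAt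
  have hconst : d =ᶠ[𝓝 x] fun _ => d x := by
    filter_upwards [hloc, hmin] with y h5 h6
    exact le_antisymm h5 h6
  have : deriv (deriv d) x = 0 := by
    rw [hconst.deriv.deriv_eq]
    simp
  linarith

/-! ### Explicit zones and uniqueness of the rescaled front. -/

namespace IsScaledFront

variable {f : ℝ → ℝ} {θig θhl b Y μ : ℝ} {U P : ℝ → ℝ}

theorem continuous (h : IsScaledFront f θig θhl b Y μ U P) : Continuous U :=
  continuous_iff_continuousAt.mpr fun x => (h.hasDerivAt x).continuousAt

theorem slope_cold (h : IsScaledFront f θig θhl b Y μ U P) {y : ℝ} (hy : y ≤ 0) :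
    P y = P 0 * Real.exp y := by
  have := eq_of_hasDerivAt_zero (f := fun x => P x * Real.exp (-x)) hy
    (h.cont.mul (by fun_prop)) fun x hx => by
      simpa using hasDerivAt_mul_exp_neg (h.cold x hx.2)
  simp only [neg_zero, Real.exp_zero, mul_one] at this
  rw [← this, mul_assoc, ← Real.exp_add]
  simp

/-- U - P is constant in the cold zone, and both U and P = P(0) e^y vanish at -∞, so the constant is
0. -/
theorem slope_zero (h : IsScaledFront f θig θhl b Y μ U P) : P 0 = θig := by
  have hc : ∀ y ≤ 0, U y - P y = U 0 - P 0 := fun y hy =>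
    eq_of_hasDerivAt_zero (f := fun x => U x - P x) hy (h.continuous.sub h.cont) fun x hx => by
      exact ((h.hasDerivAt x).sub (h.cold x hx.2)).congr_deriv (sub_self _)
  have hlim : Tendsto (fun y => U y - P 0 * Real.exp y) atBot (𝓝 (0 - P 0 * 0)) :=
    h.tendsto_cold.sub (Real.tendsto_exp_atBot.const_mul _)
  have hlim' : Tendsto (fun y => U y - P 0 * Real.exp y) atBot (𝓝 (U 0 - P 0)) := by
    refine tendsto_const_nhds.congr' ?_
    filter_upwards [eventually_le_atBot 0] with y hy
    rw [← h.slope_cold hy, hc y hy]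
  have := tendsto_nhds_unique hlim hlim'
  rw [h.ignition] at this
  linarith

theorem eq_cold (h : IsScaledFront f θig θhl b Y μ U P) {y : ℝ} (hy : y ≤ 0) :
    U y = θig * Real.exp y := by
  have : U y - P y = U 0 - P 0 :=
    eq_of_hasDerivAt_zero (f := fun x => U x - P x) hy (h.continuous.sub h.cont) fun x hx => by
      exact ((h.hasDerivAt x).sub (h.cold x hx.2)).congr_deriv (sub_self _)
  rw [h.slope_cold hy, h.slope_zero, h.ignition] at this
  linarith

theorem slope_reaction (h : IsScaledFront f θig θhl b Y μ U P) {y : ℝ} (hy : y ∈ Icc 0 Y) :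
    P y = (θig - μ) * Real.exp y + μ := by
  have := eq_of_hasDerivAt_zero (f := fun x => (P x - μ) * Real.exp (-x)) hy.1
    ((h.cont.sub continuous_const).mul (by fun_prop)) fun x hx => by
      simpa using hasDerivAt_mul_exp_neg ((h.reaction x ⟨hx.1, hx.2.trans_le hy.2⟩).sub_const μ)
  simp only [neg_zero, Real.exp_zero, mul_one, h.slope_zero] at this
  rw [this, mul_assoc, ← Real.exp_add]
  simp

theorem sub_reaction (h : IsScaledFront f θig θhl b Y μ U P) {y : ℝ} (hy : y ∈ Icc 0 Y) :
    U y = P y + μ * y := by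
  have := eq_of_hasDerivAt_zero (f := fun x => U x - P x - μ * x) hy.1
    ((h.continuous.sub h.cont).sub (by fun_prop)) fun x hx => by
      refine (((h.hasDerivAt x).sub (h.reaction x ⟨hx.1, hx.2.trans_le hy.2⟩)).sub
        ((hasDerivAt_id x).const_mul μ)).congr_deriv ?_
      ring
  simp only [h.slope_zero, h.ignition] at this
  linarith

theorem slope_heat_loss_nonneg (h : IsScaledFront f θig θhl b Y μ U P) : 0 ≤ P Y := by
  have hd : Tendsto (slope U Y) (𝓝[>] Y) (𝓝 (P Y)) :=
    (hasDerivAt_iff_tendsto_slope.mp (h.hasDerivAt Y)).mono_left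
      (nhdsWithin_mono _ fun x hx => ne_of_gt hx)
  refine ge_of_tendsto hd ?_
  filter_upwards [self_mem_nhdsWithin] with x hx
  rw [slope_def_field, h.heat_loss]
  exact div_nonneg (sub_nonneg.mpr (h.range_loss x hx).1) (sub_nonneg.mpr (le_of_lt hx))

/-- If μ ≤ θig both terms of the explicit slope are nonnegative. Otherwise the slope decreases in y,
and its value at Y is nonnegative. -/
theorem slope_reaction_nonneg (h : IsScaledFront f θig θhl b Y μ U P) {y : ℝ}
    (hy : y ∈ Icc 0 Y) : 0 ≤ P y := by
  have h1 := h.slope_heat_loss_nonneg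
  rw [h.slope_reaction ⟨h.Y_pos.le, le_rfl⟩] at h1
  rw [h.slope_reaction hy]
  have h2 : Real.exp y ≤ Real.exp Y := Real.exp_le_exp.mpr hy.2
  have h3 := Real.exp_pos y
  rcases le_total μ θig with h4 | h4
  · have := mul_nonneg (sub_nonneg.mpr h4) h3.le
    linarith [h.μ_pos]
  · nlinarith

theorem exp_sub_pos {y : ℝ} (hy : 0 < y) : 0 < Real.exp y - 1 - y := by
  linarith [Real.add_one_lt_exp hy.ne']

variable {Y₁ μ₁ Y₂ μ₂ : ℝ} {U₁ P₁ U₂ P₂ : ℝ → ℝ}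

/-- In the reaction zone U = θig e^y - μ (e^y - 1 - y), which decreases in μ for fixed y > 0, and
U₂(Y₁) ≤ U₂(Y₂) = θhl = U₁(Y₁) because U₂ is nondecreasing there. -/
theorem μ_le_of_Y_le (h₁ : IsScaledFront f θig θhl b Y₁ μ₁ U₁ P₁)
    (h₂ : IsScaledFront f θig θhl b Y₂ μ₂ U₂ P₂) (hY : Y₁ ≤ Y₂) : μ₁ ≤ μ₂ := by
  have hmono : U₂ Y₁ ≤ U₂ Y₂ := by
    rcases hY.eq_or_lt with rfl | hlt
    · rfl
    · obtain ⟨c, hc, hs⟩ := exists_hasDerivAt_eq_slope U₂ P₂ hlt h₂.continuous.continuousOn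
        fun x _ => h₂.hasDerivAt x
      have := h₂.slope_reaction_nonneg ⟨h₁.Y_pos.le.trans hc.1.le, hc.2.le⟩
      rw [hs, le_div_iff₀ (sub_pos.mpr hlt)] at this
      linarith
  rw [h₂.heat_loss, ← h₁.heat_loss, h₂.sub_reaction ⟨h₁.Y_pos.le, hY⟩,
    h₂.slope_reaction ⟨h₁.Y_pos.le, hY⟩, h₁.sub_reaction ⟨h₁.Y_pos.le, le_rfl⟩,
    h₁.slope_reaction ⟨h₁.Y_pos.le, le_rfl⟩] at hmono
  have := exp_sub_pos h₁.Y_pos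
  by_contra! hlt
  nlinarith [mul_pos (sub_pos.mpr hlt) this]

theorem hot_le (h₁ : IsScaledFront f θig θhl b Y₁ μ₁ U₁ P₁)
    (h₂ : IsScaledFront f θig θhl b Y₂ μ₂ U₂ P₂) (hf : StrictAntiOn f (Icc θhl b))
    (hfb : f b = 0) (hμ : μ₁ ≤ μ₂) {t : ℝ} (ht : 0 ≤ t) : U₁ (t + Y₁) ≤ U₂ (t + Y₂) :=
  hot_profile_le (u₁ := fun t => U₁ (t + Y₁)) (u₂ := fun t => U₂ (t + Y₂)) hf hfb h₁.μ_pos hμ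
    (fun t => (h₁.hasDerivAt (t + Y₁)).comp_add_const t Y₁)
    (fun t => (h₂.hasDerivAt (t + Y₂)).comp_add_const t Y₂)
    (fun t ht => (h₁.loss (t + Y₁) (by linarith)).comp_add_const t Y₁)
    (fun t ht => (h₂.loss (t + Y₂) (by linarith)).comp_add_const t Y₂)
    (fun t ht => h₁.range_loss _ (by linarith)) (fun t ht => h₂.range_loss _ (by linarith))
    (h₁.tendsto_hot.comp (tendsto_atTop_add_const_right _ _ tendsto_id))
    (h₂.tendsto_hot.comp (tendsto_atTop_add_const_right _ _ tendsto_id))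
    (by simp [h₁.heat_loss, h₂.heat_loss]) ht

theorem slope_le (h₁ : IsScaledFront f θig θhl b Y₁ μ₁ U₁ P₁)
    (h₂ : IsScaledFront f θig θhl b Y₂ μ₂ U₂ P₂) (hf : StrictAntiOn f (Icc θhl b))
    (hfb : f b = 0) (hμ : μ₁ ≤ μ₂) : P₁ Y₁ ≤ P₂ Y₂ := by
  have e1 : HasDerivAt (fun t => U₂ (t + Y₂) - U₁ (t + Y₁)) (P₂ Y₂ - P₁ Y₁) 0 := by
    refine HasDerivAt.sub ?_ ?_
    · exact HasDerivAt.comp_add_const 0 Y₂ (by simpa using h₂.hasDerivAt Y₂)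
    · exact HasDerivAt.comp_add_const 0 Y₁ (by simpa using h₁.hasDerivAt Y₁)
  have hd := (hasDerivAt_iff_tendsto_slope.mp e1).mono_left
      (nhdsWithin_mono (0 : ℝ) (s := Ioi 0) fun x hx => ne_of_gt hx)
  refine sub_nonneg.mp (ge_of_tendsto hd ?_)
  filter_upwards [self_mem_nhdsWithin] with x hx
  rw [slope_def_field]
  simp only [zero_add, h₁.heat_loss, h₂.heat_loss, sub_self, sub_zero]
  exact div_nonneg (sub_nonneg.mpr (hot_le h₁ h₂ hf hfb hμ (le_of_lt hx))) (le_of_lt hx)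

/-- The entry slope is θhl - μ Y, so ordered slopes give μ₂ Y₂ ≤ μ₁ Y₁, while each positive factor
is ordered the other way. -/
theorem params_eq_of_Y_le (h₁ : IsScaledFront f θig θhl b Y₁ μ₁ U₁ P₁)
    (h₂ : IsScaledFront f θig θhl b Y₂ μ₂ U₂ P₂) (hf : StrictAntiOn f (Icc θhl b))
    (hfb : f b = 0) (hY : Y₁ ≤ Y₂) : Y₁ = Y₂ ∧ μ₁ = μ₂ := by
  have hμ := μ_le_of_Y_le h₁ h₂ hY
  have hs := slope_le h₁ h₂ hf hfb hμ
  have s1 := h₁.sub_reaction ⟨h₁.Y_pos.le, le_rfl⟩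
  have s2 := h₂.sub_reaction ⟨h₂.Y_pos.le, le_rfl⟩
  rw [h₁.heat_loss] at s1
  rw [h₂.heat_loss] at s2
  have hle : μ₂ * Y₂ ≤ μ₁ * Y₁ := by linarith
  have p1 := h₁.Y_pos
  have p2 := h₁.μ_pos
  constructor
  · refine le_antisymm hY ?_
    by_contra! hlt
    nlinarith
  · refine le_antisymm hμ ?_
    by_contra! hlt
    nlinarith

theorem unique (h₁ : IsScaledFront f θig θhl b Y₁ μ₁ U₁ P₁)
    (h₂ : IsScaledFront f θig θhl b Y₂ μ₂ U₂ P₂) (hf : StrictAntiOn f (Icc θhl b))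
    (hfb : f b = 0) : Y₁ = Y₂ ∧ μ₁ = μ₂ ∧ ∀ y, U₁ y = U₂ y := by
  obtain ⟨rfl, rfl⟩ : Y₁ = Y₂ ∧ μ₁ = μ₂ := by
    rcases le_total Y₁ Y₂ with h | h
    · exact params_eq_of_Y_le h₁ h₂ hf hfb h
    · have := params_eq_of_Y_le h₂ h₁ hf hfb h
      exact ⟨this.1.symm, this.2.symm⟩
  refine ⟨rfl, rfl, fun y => ?_⟩
  rcases le_total y 0 with hy | hy
  · rw [h₁.eq_cold hy, h₂.eq_cold hy]
  rcases le_total y Y₁ with hY | hY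
  · rw [h₁.sub_reaction ⟨hy, hY⟩, h₂.sub_reaction ⟨hy, hY⟩, h₁.slope_reaction ⟨hy, hY⟩,
      h₂.slope_reaction ⟨hy, hY⟩]
  · have e1 := hot_le h₁ h₂ hf hfb le_rfl (sub_nonneg.mpr hY)
    have e2 := hot_le h₂ h₁ hf hfb le_rfl (sub_nonneg.mpr hY)
    rw [sub_add_cancel] at e1 e2
    exact le_antisymm e1 e2

end IsScaledFront

/-! ### Passage between the original and the rescaled problem. -/

theorem IsFrontSolution.isScaledFront {q h θig θhl a R c : ℝ} {θ : ℝ → ℝ} (hq : 0 < q)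
    (H : IsFrontSolution q h θig θhl a R c θ) :
    IsScaledFront (fun s => netHeat q h s / q) θig θhl (thetaPlus q h) (c * R) (q / c ^ 2)
      (fun y => θ (a + y / c)) (fun y => deriv θ (a + y / c) / c) := by
  have hc := H.c_pos
  have hphi : ∀ y : ℝ, HasDerivAt (fun y => a + y / c) (1 / c) y := fun y =>
    ((hasDerivAt_id y).div_const c).const_add a
  have hphic : Continuous fun y : ℝ => a + y / c := by fun_prop
  have hderiv : ∀ {s y : ℝ}, HasDerivAt (deriv θ) s (a + y / c) →
      HasDerivAt (fun y => deriv θ (a + y / c) / c) (s * (1 / c) / c) y := fun {s y} hs =>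
    HasDerivAt.div_const (HasDerivAt.comp (h₂ := deriv θ) y hs (hphi y)) c
  have hgt : ∀ {y : ℝ}, c * R < y → a + y / c ∈ Ioi (a + R) := fun {y} hy => by
    have : R < y / c := by rw [lt_div_iff₀ hc]; linarith
    simpa using this
  refine ⟨mul_pos hc H.R_pos, by positivity, fun y => ?_, ?_, fun y hy => ?_, ?_,
    fun y hy => ?_, fun y hy => ?_, fun y hy => H.range_loss _ (hgt hy), ?_, ?_, ?_⟩
  · have hd : HasDerivAt θ (deriv θ (a + y / c)) (a + y / c) :=
      (H.contDiff.differentiable (by norm_num) _).hasDerivAt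
    exact (HasDerivAt.comp y hd (hphi y)).congr_deriv (by ring)
  · exact ((H.contDiff.continuous_deriv le_rfl).comp hphic).div_const c
  · refine (hderiv (H.ode_cold _ ?_)).congr_deriv (by field_simp)
    have : y / c < 0 := div_neg_of_neg_of_pos hy hc
    simpa using this
  · refine H.tendsto_cold.comp (tendsto_atBot_add_const_left _ _ ?_)
    exact tendsto_id.atBot_div_const hc
  · refine (hderiv (H.ode_reaction _ ⟨?_, ?_⟩)).congr_deriv (by field_simp)
    · have : 0 < y / c := div_pos hy.1 hc
      linarith
    · have : y / c < R := by rw [div_lt_iff₀ hc]; linarith [hy.2]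
      linarith
  · exact (hderiv (H.ode_loss _ (hgt hy))).congr_deriv (by field_simp)
  · refine H.tendsto_hot.comp (tendsto_atTop_add_const_left _ _ ?_)
    exact tendsto_id.atTop_div_const hc
  · simpa using H.ignition
  · simp only [mul_div_cancel_left₀ R hc.ne', H.heat_loss]

theorem IsScaledFront.isFrontSolution {q h θig θhl Y c : ℝ} {U P : ℝ → ℝ} (hq : 0 < q)
    (hc : 0 < c)
    (H : IsScaledFront (fun s => netHeat q h s / q) θig θhl (thetaPlus q h) Y (q / c ^ 2) U P) :
    IsFrontSolution q h θig θhl 0 (Y / c) c (fun x => U (c * x)) := by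
  have hphi : ∀ x : ℝ, HasDerivAt (fun x => c * x) c x := fun x => by
    simpa using (hasDerivAt_id x).const_mul c
  have hd : ∀ x, HasDerivAt (fun x => U (c * x)) (P (c * x) * c) x := fun x =>
    HasDerivAt.comp x (H.hasDerivAt (c * x)) (hphi x)
  have hdd : deriv (fun x => U (c * x)) = fun x => P (c * x) * c := funext fun x => (hd x).deriv
  have hderiv : ∀ {s x : ℝ}, HasDerivAt P s (c * x) →
      HasDerivAt (fun x => P (c * x) * c) (s * c * c) x := fun {s x} hs =>
    (HasDerivAt.comp x hs (hphi x)).mul_const c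
  have hgt : ∀ {x : ℝ}, x ∈ Ioi (0 + Y / c) → Y < c * x := fun {x} hx => by
    have hx' : 0 + Y / c < x := hx
    rw [zero_add, div_lt_iff₀ hc] at hx'
    linarith
  refine ⟨div_pos H.Y_pos hc, hc, ?_, fun x hx => ?_, ?_, fun x hx => ?_, fun x hx => ?_,
    fun x hx => H.range_loss _ (hgt hx), ?_, ?_, ?_⟩
  · refine contDiff_one_iff_deriv.mpr ⟨fun x => (hd x).differentiableAt, ?_⟩
    rw [hdd]
    exact (H.cont.comp (continuous_const.mul continuous_id)).mul continuous_const
  · rw [hdd]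
    exact (hderiv (H.cold _ (mul_neg_of_pos_of_neg hc hx))).congr_deriv (by ring)
  · exact H.tendsto_cold.comp (tendsto_id.const_mul_atBot hc)
  · rw [hdd]
    have hx2 := hx.2
    rw [zero_add, lt_div_iff₀ hc] at hx2
    refine (hderiv (H.reaction _ ⟨mul_pos hc hx.1, by linarith⟩)).congr_deriv ?_
    field_simp
  · rw [hdd]
    refine (hderiv (H.loss _ (hgt hx))).congr_deriv ?_
    field_simp
  · exact H.tendsto_hot.comp (tendsto_id.const_mul_atTop hc)
  · simpa using H.ignition
  · simp only [zero_add, mul_div_cancel₀ Y hc.ne', H.heat_loss]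

/-! ### Gluing the zones and existence of the rescaled front. -/

theorem hasDerivAt_ite_le {f f' g g' : ℝ → ℝ} {a : ℝ} (hf : ∀ x, HasDerivAt f (f' x) x)
    (hg : ∀ x, a ≤ x → HasDerivAt g (g' x) x) (h : f a = g a) (h' : f' a = g' a) (x : ℝ) :
    HasDerivAt (fun x => if x ≤ a then f x else g x) (if x ≤ a then f' x else g' x) x := by
  rcases lt_trichotomy x a with hx | rfl | hx
  · rw [if_pos hx.le]
    refine (hf x).congr_of_eventuallyEq ?_
    filter_upwards [Iio_mem_nhds hx] with y hy
    exact if_pos (le_of_lt hy)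
  · rw [if_pos le_rfl, ← hasDerivWithinAt_univ, ← Iic_union_Ici (a := x)]
    refine HasDerivWithinAt.union ?_ ?_
    · exact (hf x).hasDerivWithinAt.congr (fun y hy => if_pos hy) (if_pos le_rfl)
    · rw [h']
      refine (hg x le_rfl).hasDerivWithinAt.congr (fun y hy => ?_) (by rw [if_pos le_rfl, h])
      rcases eq_or_lt_of_le (show x ≤ y from hy) with rfl | hlt
      · rw [if_pos le_rfl, h]
      · exact if_neg (not_le.mpr hlt)
  · rw [if_neg (not_le.mpr hx)]
    refine (hg x hx.le).congr_of_eventuallyEq ?_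
    filter_upwards [Ioi_mem_nhds hx] with y hy
    exact if_neg (not_le.mpr hy)

/-- A trapped hot zone trajectory that matches the reaction zone extends to a front. -/
theorem IsScaledFront.of_trajectory {f : ℝ → ℝ} {θig θhl b Y μ : ℝ} {u p : ℝ → ℝ} (hY : 0 < Y)
    (hμ : 0 < μ) (hig : 0 < θig) (hθhl : θhl = (θig - μ) * Real.exp Y + μ + μ * Y)
    (hu0 : u 0 = θhl) (hp0 : p 0 = θhl - μ * Y) (hpos : ∀ t, 0 ≤ t → 0 < p t)
    (hu : ∀ t, 0 ≤ t → HasDerivAt u (p t) t)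
    (hp : ∀ t, 0 ≤ t → HasDerivAt p (p t - μ * f (u t)) t)
    (hr : ∀ t, 0 ≤ t → u t ∈ Icc θhl b) (hlim : Tendsto u atTop (𝓝 b)) :
    ∃ U P : ℝ → ℝ, IsScaledFront f θig θhl b Y μ U P ∧ ∀ y, 0 < P y := by
  set U₁ : ℝ → ℝ := fun y => if y ≤ Y then (θig - μ) * Real.exp y + μ + μ * y else u (y - Y)
    with hU₁
  set P₁ : ℝ → ℝ := fun y => if y ≤ Y then (θig - μ) * Real.exp y + μ else p (y - Y) with hP₁
  set U : ℝ → ℝ := fun y => if y ≤ 0 then θig * Real.exp y else U₁ y with hU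
  set P : ℝ → ℝ := fun y => if y ≤ 0 then θig * Real.exp y else P₁ y with hP
  have mid' : ∀ y, HasDerivAt (fun y => (θig - μ) * Real.exp y + μ)
      ((θig - μ) * Real.exp y) y := fun y =>
    ((Real.hasDerivAt_exp y).const_mul _).add_const _
  have mid : ∀ y, HasDerivAt (fun y => (θig - μ) * Real.exp y + μ + μ * y)
      ((θig - μ) * Real.exp y + μ) y := fun y => by
    refine ((mid' y).add ((hasDerivAt_id y).const_mul μ)).congr_deriv ?_
    rw [mul_one]
  have hot : ∀ y, Y ≤ y → HasDerivAt (fun y => u (y - Y)) (p (y - Y)) y := fun y hy =>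
    (hu (y - Y) (by linarith)).comp_sub_const y Y
  have hot' : ∀ y, Y ≤ y → HasDerivAt (fun y => p (y - Y)) (p (y - Y) - μ * f (u (y - Y))) y :=
    fun y hy => (hp (y - Y) (by linarith)).comp_sub_const y Y
  have d1 : ∀ y, HasDerivAt U₁ (P₁ y) y := by
    refine hasDerivAt_ite_le mid hot ?_ ?_
    · simp only [sub_self, hu0, hθhl]
    · simp only [sub_self, hp0]; linarith
  have hU₁0 : U₁ 0 = θig := by simp [hU₁, hY.le]
  have hP₁0 : P₁ 0 = θig := by simp [hP₁, hY.le]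
  have d2 : ∀ y, HasDerivAt U (P y) y := by
    refine hasDerivAt_ite_le (fun y => (Real.hasDerivAt_exp y).const_mul _) (fun y _ => d1 y) ?_ ?_
    · rw [hU₁0]; simp
    · rw [hP₁0]; simp
  have c1 : Continuous P₁ := by
    refine continuous_if_le continuous_id continuous_const (by fun_prop)
      (fun y hy => (hot' y hy).continuousAt.continuousWithinAt) fun y hy => ?_
    rw [show y = Y from hy, sub_self, hp0]
    linarith
  have c2 : Continuous P := by
    refine continuous_if_le continuous_id continuous_const (by fun_prop) c1.continuousOn
      fun y hy => ?_
    rw [show y = 0 from hy, hP₁0]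
    simp
  have eU : ∀ y, Y < y → U y = u (y - Y) := fun y hy => by
    simp only [hU, hU₁]
    rw [if_neg (not_le.mpr (hY.trans hy)), if_neg (not_le.mpr hy)]
  have eP : ∀ y, Y < y → P y = p (y - Y) := fun y hy => by
    simp only [hP, hP₁]
    rw [if_neg (not_le.mpr (hY.trans hy)), if_neg (not_le.mpr hy)]
  have eP' : ∀ y ∈ Ioc 0 Y, P y = (θig - μ) * Real.exp y + μ := fun y hy => by
    simp [hP, hP₁, hy.1, hy.2]
  have hPY : 0 < (θig - μ) * Real.exp Y + μ := by
    have := hpos 0 le_rfl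
    rw [hp0] at this
    linarith
  refine ⟨U, P, ⟨hY, hμ, d2, c2, fun y hy => ?_, ?_, fun y hy => ?_, fun y hy => ?_,
    fun y hy => ?_, ?_, ?_, ?_⟩, fun y => ?_⟩
  · have : P y = θig * Real.exp y := if_pos hy.le
    rw [this]
    refine ((Real.hasDerivAt_exp y).const_mul θig).congr_of_eventuallyEq ?_
    filter_upwards [Iio_mem_nhds hy] with z hz
    exact if_pos (le_of_lt hz)
  · have : Tendsto (fun y => θig * Real.exp y) atBot (𝓝 (θig * 0)) :=
      Real.tendsto_exp_atBot.const_mul _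
    rw [mul_zero] at this
    refine this.congr' ?_
    filter_upwards [eventually_le_atBot 0] with y hy
    exact (if_pos hy).symm
  · rw [eP' y ⟨hy.1, hy.2.le⟩, add_sub_cancel_right]
    refine (mid' y).congr_of_eventuallyEq ?_
    filter_upwards [Ioo_mem_nhds hy.1 hy.2] with z hz
    exact eP' z ⟨hz.1, hz.2.le⟩
  · rw [eP y hy, eU y hy]
    refine (hot' y hy.le).congr_of_eventuallyEq ?_
    filter_upwards [Ioi_mem_nhds hy] with z hz
    exact eP z hz
  · rw [eU y hy]
    exact hr _ (by linarith)
  · refine (hlim.comp (tendsto_atTop_add_const_right _ (-Y) tendsto_id)).congr' ?_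
    filter_upwards [eventually_gt_atTop Y] with y hy
    rw [eU y hy]
    rfl
  · simp [hU]
  · simp [hU, hU₁, not_le.mpr hY, hθhl]
  · rcases le_or_gt y 0 with h0 | h0
    · have : P y = θig * Real.exp y := if_pos h0
      rw [this]
      positivity
    rcases le_or_gt y Y with h1 | h1
    · rw [eP' y ⟨h0, h1⟩]
      have h2 : Real.exp y ≤ Real.exp Y := Real.exp_le_exp.mpr h1
      have h3 := Real.exp_pos y
      rcases le_total μ θig with h4 | h4
      · have := mul_nonneg (sub_nonneg.mpr h4) h3.le
        linarith
      · nlinarith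
    · rw [eP y h1]
      exact hpos _ (by linarith)

theorem exists_isScaledFront {f g : ℝ → ℝ} {θig θhl b : ℝ} {k : NNReal} (hig : 0 < θig)
    (hhl : θig < θhl) (hb : θhl < b) (hg : LipschitzWith k g) (hanti : Antitone g)
    (hg1 : ∀ x, g x ≤ 1) (hgpos : ∀ x, x < b → 0 < g x) (hgb : ∀ x, b ≤ x → g x = 0)
    (hfg : ∀ x ∈ Icc θhl b, g x = f x) :
    ∃ (Y μ : ℝ) (U P : ℝ → ℝ), IsScaledFront f θig θhl b Y μ U P ∧ ∀ y, 0 < P y := by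
  have hg0 : ∀ x, 0 ≤ g x := fun x => by
    rcases lt_or_ge x b with h | h
    · exact (hgpos x h).le
    · exact (hgb x h).ge
  have hhl0 : 0 < θhl := hig.trans hhl
  have hρ : 0 < θhl / θig := div_pos hhl0 hig
  have hρ1 : 1 < θhl / θig := (one_lt_div hig).mpr hhl
  have hlog : 0 < Real.log (θhl / θig) := Real.log_pos hρ1
  have hle : Real.log (θhl / θig) ≤ θhl / θig := by
    linarith [Real.log_le_sub_one_of_pos hρ]
  -- The shooting parameter is Y. At the left endpoint the matched μ is 0 and the slope is θhl > 0;
  -- at the right endpoint the slope is negative.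
  set T := Icc (Real.log (θhl / θig)) (θhl / θig)
  have : PreconnectedSpace T := Subtype.preconnectedSpace isPreconnected_Icc
  have hTpos : ∀ i : T, 0 < (i : ℝ) := fun i => hlog.trans_le i.2.1
  have hden : ∀ i : T, 0 < Real.exp i - 1 - i := fun i => IsScaledFront.exp_sub_pos (hTpos i)
  set m : T → ℝ := fun i => (θig * Real.exp i - θhl) / (Real.exp i - 1 - i) with hm
  set s : T → ℝ := fun i => θhl - m i * i with hs
  have hmc : Continuous m := Continuous.div (by fun_prop) (by fun_prop) fun i => (hden i).ne'
  have hsc : Continuous s := by fun_prop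
  have hm0 : ∀ i, 0 ≤ m i := fun i => by
    refine div_nonneg ?_ (hden i).le
    have : θhl / θig ≤ Real.exp i := (Real.log_le_iff_le_exp hρ).mp i.2.1
    rw [div_le_iff₀ hig] at this
    linarith
  obtain ⟨B, hB⟩ := (isCompact_range hmc).bddAbove
  have hmB : ∀ i, m i + 1 ≤ B + 1 := fun i => by linarith [hB (mem_range_self i)]
  have hstart : m ⟨_, le_rfl, hle⟩ < s ⟨_, le_rfl, hle⟩ := by
    have : m ⟨_, le_rfl, hle⟩ = 0 := by
      simp only [hm]
      rw [Real.exp_log hρ, mul_div_cancel₀ _ hig.ne', sub_self, zero_div]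
    simp only [hs, this]
    linarith
  have hend : s ⟨_, hle, le_rfl⟩ < 0 := by
    have h1 := hden ⟨_, hle, le_rfl⟩
    have h2 : m ⟨_, hle, le_rfl⟩ * (Real.exp (θhl / θig) - 1 - θhl / θig) =
        θig * Real.exp (θhl / θig) - θhl := div_mul_cancel₀ _ h1.ne'
    simp only [hs]
    set M := m ⟨_, hle, le_rfl⟩
    set E := Real.exp (θhl / θig)
    have h3 : θhl = θhl / θig * θig := (div_mul_cancel₀ _ hig.ne').symm
    set r := θhl / θig
    simp only at h1
    have h4 : (θhl - M * r) * (E - 1 - r) = -θhl := by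
      have : (θhl - M * r) * (E - 1 - r) = θhl * (E - 1 - r) - r * (M * (E - 1 - r)) := by ring
      rw [this, h2, h3]
      ring
    by_contra! h5
    linarith [mul_nonneg h5 h1.le]
  obtain ⟨i, u, p, hu0, hp0, htrap, hu, hp⟩ :=
    exists_trapped_trajectory hsc hmc hm0 hmB hstart hend hg hg0 hg1 θhl
  -- If m i = 0 the initial slope would be θhl > 0, outside the trapping interval [0, 0].
  have hμ : 0 < m i := by
    refine lt_of_le_of_ne (hm0 i) fun h => ?_
    have := (htrap 0 le_rfl).2
    rw [hp0] at this
    simp only [hs, ← h] at this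
    linarith
  obtain ⟨hpos, hlt, hlim⟩ := trapped_trajectory hμ hg hanti hgpos hgb (by rwa [hu0]) htrap hu hp
  have hr : ∀ t, 0 ≤ t → u t ∈ Icc θhl b := fun t ht => by
    refine ⟨?_, (hlt t ht).le⟩
    have := add_mul_le_of_le_hasDerivAt (e := 0) hu (fun r hr => (hpos r hr).le) ht
    linarith
  have hmatch : θhl = (θig - m i) * Real.exp i + m i + m i * i := by
    have : m i * (Real.exp i - 1 - i) = θig * Real.exp i - θhl := div_mul_cancel₀ _ (hden i).ne'
    linarith
  exact ⟨i, m i, IsScaledFront.of_trajectory (hTpos i) hμ hig hmatch hu0 hp0 hpos hu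
    (fun t ht => by rw [← hfg _ (hr t ht)]; exact hp t ht) hr hlim⟩

/-! ### The net heat production and its globally Lipschitz extension. -/

section Heat

variable {q h : ℝ}

theorem one_add_thetaPlus_pow (hq : 0 < q) (hh : 0 < h) : (1 + thetaPlus q h) ^ 4 = 1 + q / h := by
  have : 0 ≤ 1 + q / h := by positivity
  rw [thetaPlus, add_sub_cancel, ← Real.rpow_natCast, ← Real.rpow_mul this]
  norm_num

theorem netHeat_thetaPlus (hq : 0 < q) (hh : 0 < h) : netHeat q h (thetaPlus q h) = 0 := by
  rw [netHeat, one_add_thetaPlus_pow hq hh]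
  field_simp
  ring

theorem netHeat_strictAntiOn (hh : 0 < h) : StrictAntiOn (netHeat q h) (Ici 0) := by
  intro x hx y hy hxy
  have hx' : (0 : ℝ) ≤ x := hx
  have : (1 + x) ^ 4 < (1 + y) ^ 4 := pow_lt_pow_left₀ (by linarith) (by linarith) (by norm_num)
  unfold netHeat
  nlinarith

/-- The normalised net heat production, extended by constants outside `[0, θ₊]`. -/
noncomputable def clampedHeat (q h x : ℝ) : ℝ :=
  netHeat q h (max 0 (min x (thetaPlus q h))) / q

theorem lipschitzWith_clampedHeat (hq : 0 < q) (hh : 0 < h) (hb : 0 ≤ thetaPlus q h) :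
    ∃ k, LipschitzWith k (clampedHeat q h) := by
  set M := 1 + thetaPlus q h with hM
  have hM0 : 0 ≤ M := by linarith
  refine ⟨Real.toNNReal (4 * M ^ 3 * h / q), LipschitzWith.of_dist_le_mul fun x y => ?_⟩
  rw [Real.coe_toNNReal _ (by positivity), Real.dist_eq, Real.dist_eq]
  have hcl : |max 0 (min x (thetaPlus q h)) - max 0 (min y (thetaPlus q h))| ≤ |x - y| := by
    have := ((LipschitzWith.id (α := ℝ).min_const (thetaPlus q h)).const_max 0).dist_le_mul x y
    simpa [Real.dist_eq] using this
  unfold clampedHeat netHeat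
  have hmem : ∀ x, 0 ≤ max 0 (min x (thetaPlus q h)) ∧
      max 0 (min x (thetaPlus q h)) ≤ thetaPlus q h := fun x =>
    ⟨le_max_left _ _, max_le hb (min_le_right _ _)⟩
  obtain ⟨a0, a1⟩ := hmem x
  obtain ⟨b0, b1⟩ := hmem y
  set a := max 0 (min x (thetaPlus q h))
  set b := max 0 (min y (thetaPlus q h))
  have key : (q - h * ((1 + a) ^ 4 - 1)) / q - (q - h * ((1 + b) ^ 4 - 1)) / q =
      -(h / q * ((1 + a) ^ 3 + (1 + a) ^ 2 * (1 + b) + (1 + a) * (1 + b) ^ 2 + (1 + b) ^ 3) *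
        (a - b)) := by
    field_simp
    ring
  have ha : 1 + a ≤ M := by linarith
  have hb' : 1 + b ≤ M := by linarith
  have hsum : (1 + a) ^ 3 + (1 + a) ^ 2 * (1 + b) + (1 + a) * (1 + b) ^ 2 + (1 + b) ^ 3 ≤
      M ^ 3 + M ^ 2 * M + M * M ^ 2 + M ^ 3 := by gcongr
  rw [key, abs_neg, abs_mul]
  refine mul_le_mul ?_ hcl (abs_nonneg _) (by positivity)
  rw [abs_of_nonneg (by positivity)]
  calc h / q * ((1 + a) ^ 3 + (1 + a) ^ 2 * (1 + b) + (1 + a) * (1 + b) ^ 2 + (1 + b) ^ 3)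
      ≤ h / q * (M ^ 3 + M ^ 2 * M + M * M ^ 2 + M ^ 3) :=
        mul_le_mul_of_nonneg_left hsum (by positivity)
    _ = 4 * M ^ 3 * h / q := by ring

theorem antitone_clampedHeat (hq : 0 < q) (hh : 0 < h) : Antitone (clampedHeat q h) := by
  intro x y hxy
  unfold clampedHeat
  gcongr
  exact (netHeat_strictAntiOn hh).antitoneOn (mem_Ici.mpr (le_max_left _ _))
    (mem_Ici.mpr (le_max_left _ _)) (by gcongr)

/-- The bound is F(0)/q; it is what makes μ the upper barrier for the slope. -/
theorem clampedHeat_le_one (hq : 0 < q) (hh : 0 < h) (x : ℝ) : clampedHeat q h x ≤ 1 := by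
  unfold clampedHeat
  rw [div_le_one hq]
  have := (netHeat_strictAntiOn (q := q) hh).antitoneOn (mem_Ici.mpr le_rfl)
    (mem_Ici.mpr (le_max_left 0 (min x (thetaPlus q h)))) (le_max_left _ _)
  refine this.trans ?_
  simp [netHeat]

theorem clampedHeat_pos (hq : 0 < q) (hh : 0 < h) (hb : 0 < thetaPlus q h) {x : ℝ}
    (hx : x < thetaPlus q h) : 0 < clampedHeat q h x := by
  refine div_pos ?_ hq
  have := netHeat_strictAntiOn (q := q) hh (mem_Ici.mpr (le_max_left 0 x)) (mem_Ici.mpr hb.le)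
    (max_lt hb hx)
  rwa [netHeat_thetaPlus hq hh, ← min_eq_left hx.le] at this

theorem clampedHeat_eq_zero (hq : 0 < q) (hh : 0 < h) (hb : 0 < thetaPlus q h) {x : ℝ}
    (hx : thetaPlus q h ≤ x) : clampedHeat q h x = 0 := by
  rw [clampedHeat, min_eq_right hx, max_eq_right hb.le, netHeat_thetaPlus hq hh, zero_div]

end Heat

theorem theorem1 (q h θig θhl : ℝ) (hq : 0 < q) (hh : 0 < h)
    (hig : 0 < θig) (hhl : θig < θhl) (hplus : θhl < thetaPlus q h) :
    ∃ (Rs cs : ℝ) (θs : ℝ → ℝ),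
      IsFrontSolution q h θig θhl 0 Rs cs θs ∧
      StrictMono θs ∧
      (∀ x ∈ Iio (0 : ℝ), θs x ∈ Ioo 0 θig) ∧
      (∀ x ∈ Ioo 0 Rs, θs x ∈ Ioo θig θhl) ∧
      (∀ x ∈ Ioi Rs, θs x ∈ Ioo θhl (thetaPlus q h)) ∧
      ∀ (a R c : ℝ) (θ : ℝ → ℝ), IsFrontSolution q h θig θhl a R c θ →
        R = Rs ∧ c = cs ∧ ∀ x, θ x = θs (x - a) := by
  have hhl0 : 0 < θhl := hig.trans hhl
  have hb : 0 < thetaPlus q h := hhl0.trans hplus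
  obtain ⟨k, hk⟩ := lipschitzWith_clampedHeat hq hh hb.le
  obtain ⟨Y, μ, U, P, H, hP⟩ := exists_isScaledFront (f := fun s => netHeat q h s / q) hig hhl
    hplus hk (antitone_clampedHeat hq hh) (clampedHeat_le_one hq hh)
    (fun x hx => clampedHeat_pos hq hh hb hx) (fun x hx => clampedHeat_eq_zero hq hh hb hx)
    (fun x hx => by rw [clampedHeat, min_eq_left hx.2, max_eq_right (hhl0.le.trans hx.1)])
  have hμ := H.μ_pos
  obtain ⟨c, hc, rfl⟩ : ∃ c : ℝ, 0 < c ∧ μ = q / c ^ 2 := by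
    refine ⟨√(q / μ), Real.sqrt_pos.mpr (by positivity), ?_⟩
    rw [Real.sq_sqrt (by positivity)]
    field_simp
  have hf : StrictAntiOn (fun s => netHeat q h s / q) (Icc θhl (thetaPlus q h)) :=
    fun x hx y hy hxy => div_lt_div_of_pos_right
      (netHeat_strictAntiOn hh (hhl0.le.trans hx.1) (hhl0.le.trans hy.1) hxy) hq
  have hfb : netHeat q h (thetaPlus q h) / q = 0 := by rw [netHeat_thetaPlus hq hh, zero_div]
  have hmono : StrictMono U := strictMono_of_deriv_pos fun y => by
    rw [(H.hasDerivAt y).deriv]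
    exact hP y
  have hmono' : StrictMono fun x => U (c * x) := hmono.comp (strictMono_mul_left_of_pos hc)
  have HF := H.isFrontSolution hq hc
  refine ⟨Y / c, c, fun x => U (c * x), HF, hmono', fun x hx => ⟨?_, ?_⟩, fun x hx => ⟨?_, ?_⟩,
    fun x hx => ⟨?_, ?_⟩, fun a R c' θ Hθ => ?_⟩
  · have : c * x ≤ 0 := (mul_neg_of_pos_of_neg hc hx).le
    simp only [H.eq_cold this]
    positivity
  · exact (hmono' hx).trans_eq HF.ignition
  · exact HF.ignition.symm.trans_lt (hmono' hx.1)
  · have := hmono' hx.2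
    rw [← zero_add (Y / c)] at this
    exact this.trans_eq HF.heat_loss
  · have hx' : Y / c < x := hx
    rw [← zero_add (Y / c)] at hx'
    exact HF.heat_loss.symm.trans_lt (hmono' hx')
  · have hx' : Y / c < x := hx
    -- The range condition only gives ≤ θ₊; applying it at x + 1 and using strict monotonicity makes
    -- the inequality strict at x.
    have h1 : x < x + 1 := lt_add_one x
    refine (hmono' h1).trans_le (HF.range_loss _ ?_).2
    rw [zero_add]
    exact hx'.trans h1
  · obtain ⟨hY, hμ', hU⟩ := (Hθ.isScaledFront hq).unique H hf hfb
    have hc' := Hθ.c_pos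
    have hcc : c' = c := by
      have : c' ^ 2 = c ^ 2 := by
        rw [div_eq_div_iff (by positivity) (by positivity)] at hμ'
        exact (mul_left_cancel₀ hq.ne' hμ').symm
      exact (pow_left_inj₀ hc'.le hc.le (by norm_num)).mp this
    subst hcc
    refine ⟨by rw [← hY]; field_simp, rfl, fun x => ?_⟩
    simpa [mul_div_cancel_left₀ _ hc'.ne'] using hU (c' * (x - a))
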